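/- Let $\Lambda$ and $H$ be countable discrete groups such that $\Lambda$ has at least two elements, and let $\Lambda\wr H=\bigl(\bigoplus_{h\in H}\Lambda\bigr)\rtimes H$ be their (restricted) wreath product, where $\bigoplus_{h\in H}\Lambda$ is the group of finitely supported functions $H\to\Lambda$ and $H$ acts on it by shifting the indices. A discrete group $G$ is called maximally almost periodic (MAP) if its irreducible finite-dimensional unitary representations $G\to U(n)$ separate the points of $G$, and residually finite (RF) if the intersection of its normal subgroups of finite index is trivial. (i) $\Lambda\wr H$ is MAP if and only if $\Lambda$ is MAP, $H$ is RF, and either $H$ is finite or $\Lambda$ is abelian. (ii) $\Lambda\wr H$ is RF if and only if $\Lambda$ and $H$ are both RF, and either $H$ is finite or $\Lambda$ is abelian. -/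

import Mathlib

/-- The restricted direct sum `⨁_{h ∈ H} Λ`: the group of finitely supported functions `H → Λ`
with pointwise multiplication. -/
def finSuppPower (Λ H : Type*) [Group Λ] : Subgroup (H → Λ) where
  carrier := {f | (Function.mulSupport f).Finite}
  one_mem' := by simp
  mul_mem' {f g} hf hg := (Set.Finite.union hf hg).subset (Function.mulSupport_mul f g)
  inv_mem' {f} hf := by
    simpa only [Set.mem_ofPred_eq, Function.mulSupport_inv] using hf

theorem mem_finSuppPower {Λ H : Type*} [Group Λ] {f : H → Λ} :
    f ∈ finSuppPower Λ H ↔ (Function.mulSupport f).Finite :=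
  Iff.rfl

theorem shift_mem_finSuppPower {Λ H : Type*} [Group Λ] [Group H] (a : H) {f : H → Λ}
    (hf : f ∈ finSuppPower Λ H) : (fun h => f (a * h)) ∈ finSuppPower Λ H :=
  Set.Finite.preimage (Set.injOn_of_injective (mul_right_injective a)) hf

/-- The action of `H` on `⨁_{h ∈ H} Λ` by shifting the indices: `(a • f) h = f (a⁻¹ h)`. -/
def shiftAction (Λ H : Type*) [Group Λ] [Group H] : H →* MulAut (finSuppPower Λ H) where
  toFun a :=
    { toFun := fun f => ⟨fun h => f.1 (a⁻¹ * h), shift_mem_finSuppPower a⁻¹ f.2⟩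
      invFun := fun f => ⟨fun h => f.1 (a * h), shift_mem_finSuppPower a f.2⟩
      left_inv := fun f => by ext h; simp
      right_inv := fun f => by ext h; simp
      map_mul' := fun f g => by ext h; rfl }
  map_one' := by ext f h; simp
  map_mul' a b := by ext f h; simp [mul_assoc]

/-- The (restricted) wreath product `Λ ≀ H = (⨁_{h ∈ H} Λ) ⋊ H`. -/
abbrev RestrictedWreathProduct (Λ H : Type*) [Group Λ] [Group H] : Type _ :=
  finSuppPower Λ H ⋊[shiftAction Λ H] H

/-- The linear representation on `ℂⁿ` given by a homomorphism `σ : G → U(n)`. -/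
noncomputable def unitaryToRepresentation {G : Type*} [Group G] {n : ℕ}
    (σ : G →* Matrix.unitaryGroup (Fin n) ℂ) : Representation ℂ G (Fin n → ℂ) :=
  ((Matrix.toLinAlgEquiv' : Matrix (Fin n) (Fin n) ℂ ≃ₐ[ℂ] _) :
    Matrix (Fin n) (Fin n) ℂ →* ((Fin n → ℂ) →ₗ[ℂ] (Fin n → ℂ))).comp
    ((Matrix.unitaryGroup (Fin n) ℂ).subtype.comp σ)

/-- A (discrete) group is maximally almost periodic (MAP) if its irreducible finite dimensional
unitary representations separate its points. -/
def IsMaximallyAlmostPeriodic (G : Type*) [Group G] : Prop :=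
  ∀ x y : G, x ≠ y → ∃ (n : ℕ) (σ : G →* Matrix.unitaryGroup (Fin n) ℂ),
    (unitaryToRepresentation σ).IsIrreducible ∧ σ x ≠ σ y

/-! Necessity: MAP and RF pass to the subgroup `Λ`, and RF implies MAP, so only MAP matters for the
rest. For infinite `H`, the copies of `Λ` at distinct indices commute, but the finite-dimensional
endomorphism algebra admits no infinite family of mutually commuting noncommuting pairs
(`exists_commute_of_pairwise_commute`). So every commutator of `Λ` dies at some index, hence by
conjugation at all, and `Λ` is abelian. The base then acts by commuting unitaries, and `H` permutes
their finitely many joint eigenspaces; a finite index subgroup fixes them all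
(`exists_finiteIndex_forall_map_eq`), which makes `H` RF.

Sufficiency: for finite `H`, induce monomial representations from `Λ`, or pass to finite quotients
of `Λ`. For abelian `Λ`, multiplying over the fibers of `H → H ⧸ N` maps `Λ ≀ H` to `Λ ≀ (H ⧸ N)`,
reducing to finite `H`. -/

/-- The unitary matrices are the linear isometries of the Euclidean space. -/
noncomputable def unitaryGroupEquivLinearIsometryEquiv (n : ℕ) :
    Matrix.unitaryGroup (Fin n) ℂ ≃*
      (EuclideanSpace ℂ (Fin n) ≃ₗᵢ[ℂ] EuclideanSpace ℂ (Fin n)) :=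
  (Unitary.mapEquiv
    { MulEquivClass.toMulEquiv (Matrix.toEuclideanCLM (𝕜 := ℂ) (n := Fin n)) with
      map_star' := map_star (Matrix.toEuclideanCLM (𝕜 := ℂ) (n := Fin n)) }).toMulEquiv.trans
    Unitary.linearIsometryEquiv

theorem unitaryToRepresentation_apply {G : Type*} [Group G] {n : ℕ}
    (σ : G →* Matrix.unitaryGroup (Fin n) ℂ) (g : G) (v : EuclideanSpace ℂ (Fin n)) :
    unitaryToRepresentation σ g v.ofLp =
      (unitaryGroupEquivLinearIsometryEquiv n (σ g) v).ofLp := by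
  simp [unitaryToRepresentation, unitaryGroupEquivLinearIsometryEquiv]
  rfl

/-- Conjugation by a linear isometry equivalence. -/
def LinearIsometryEquiv.conjMulEquiv {V W : Type*} [NormedAddCommGroup V] [NormedAddCommGroup W]
    [InnerProductSpace ℂ V] [InnerProductSpace ℂ W] (e : V ≃ₗᵢ[ℂ] W) :
    (V ≃ₗᵢ[ℂ] V) ≃* (W ≃ₗᵢ[ℂ] W) where
  toFun u := (e.symm.trans u).trans e
  invFun u := (e.trans u).trans e.symm
  left_inv u := by ext; simp
  right_inv u := by ext; simp
  map_mul' u v := by ext; simp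

/-- An isometric action preserves the orthogonal complement of an invariant subspace. -/
theorem map_mem_orthogonal_of_forall_map_mem {G V : Type*} [Group G] [NormedAddCommGroup V]
    [InnerProductSpace ℂ V] (ρ : G →* (V ≃ₗᵢ[ℂ] V)) {U : Submodule ℂ V}
    (hU : ∀ g, ∀ v ∈ U, ρ g v ∈ U) (g : G) {v : V} (hv : v ∈ Uᗮ) : ρ g v ∈ Uᗮ := by
  intro u hu
  have h := hv _ (hU g⁻¹ u hu)
  rw [← (ρ g).inner_map_map, map_inv] at h
  simpa [LinearIsometryEquiv.inv_def] using h

/-- The restriction of an isometric action to an invariant subspace. -/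
def restrictIsometricAction {G V : Type*} [Group G] [NormedAddCommGroup V]
    [InnerProductSpace ℂ V] (ρ : G →* (V ≃ₗᵢ[ℂ] V)) (U : Submodule ℂ V)
    (hU : ∀ g, ∀ v ∈ U, ρ g v ∈ U) : G →* (U ≃ₗᵢ[ℂ] U) where
  toFun g :=
    { toFun := fun v => ⟨ρ g v, hU g v v.2⟩
      invFun := fun v => ⟨ρ g⁻¹ v, hU g⁻¹ v v.2⟩
      map_add' := fun v w => by ext; simp
      map_smul' := fun c v => by ext; simp
      left_inv := fun v => by ext; simp [LinearIsometryEquiv.inv_def]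
      right_inv := fun v => by ext; simp [LinearIsometryEquiv.inv_def]
      norm_map' := fun v => by
        change ‖ρ g v‖ = ‖(v : V)‖
        simp }
  map_one' := by ext v; simp
  map_mul' g h := by ext v; simp

/-- Supplies the irreducibility in the definition of MAP. In a minimal invariant `W` not fixed
pointwise by `x`, a proper nonzero invariant `U` would split `W` into `U` and `W ⊓ Uᗮ`, both smaller
and so both fixed by `x`. -/
theorem exists_minimal_invariant_not_fixed {G V : Type*} [Group G] [NormedAddCommGroup V]
    [InnerProductSpace ℂ V] [FiniteDimensional ℂ V] (ρ : G →* (V ≃ₗᵢ[ℂ] V)) {x : G}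
    (hx : ρ x ≠ 1) :
    ∃ W : Submodule ℂ V, (∀ g, ∀ v ∈ W, ρ g v ∈ W) ∧ (∃ v ∈ W, ρ x v ≠ v) ∧
      ∀ U ≤ W, (∀ g, ∀ v ∈ U, ρ g v ∈ U) → U = ⊥ ∨ U = W := by
  obtain ⟨v₀, hv₀⟩ : ∃ v, ρ x v ≠ v := by
    contrapose! hx
    ext v
    simp [hx]
  let S : Set (Submodule ℂ V) := {W | (∀ g, ∀ v ∈ W, ρ g v ∈ W) ∧ ∃ v ∈ W, ρ x v ≠ v}
  obtain ⟨W, ⟨hW, v₁, hv₁, hv₁x⟩, hmin⟩ := WellFounded.has_min (wellFounded_lt) S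
    ⟨⊤, fun _ _ _ => trivial, v₀, trivial, hv₀⟩
  refine ⟨W, hW, ⟨v₁, hv₁, hv₁x⟩, fun U hUW hU => ?_⟩
  by_contra! hne
  have key (U' : Submodule ℂ V) (hU' : ∀ g, ∀ v ∈ U', ρ g v ∈ U') (hlt : U' < W) :
      ∀ v ∈ U', ρ x v = v := by
    by_contra! hcon
    exact hmin U' ⟨hU', hcon⟩ hlt
  have h₁ := key U hU (lt_of_le_of_ne hUW hne.2)
  have h₂ := key (W ⊓ Uᗮ)
    (fun g v hv => ⟨hW g v hv.1, map_mem_orthogonal_of_forall_map_mem ρ hU g hv.2⟩)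
    (lt_of_le_of_ne inf_le_left fun h => hne.1 (by
      have hle : W ≤ Uᗮ := inf_eq_left.mp h
      exact le_bot_iff.mp fun u hu =>
        (Submodule.mem_bot ℂ).mpr (inner_self_eq_zero.mp (hle (hUW hu) u hu))))
  obtain ⟨u, hu, w, hw, rfl⟩ := Submodule.exists_add_mem_mem_orthogonal (K := U) v₁
  refine hv₁x ?_
  rw [map_add, h₁ u hu, h₂ w ⟨?_, hw⟩]
  simpa using W.sub_mem hv₁ (hUW hu)

/-- A group is maximally almost periodic iff its unitary representations on finite dimensional
spaces separate the points from the identity. -/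
theorem isMaximallyAlmostPeriodic_iff {G : Type*} [Group G] :
    IsMaximallyAlmostPeriodic G ↔ ∀ x : G, x ≠ 1 → ∃ (n : ℕ)
      (ρ : G →* (EuclideanSpace ℂ (Fin n) ≃ₗᵢ[ℂ] EuclideanSpace ℂ (Fin n))), ρ x ≠ 1 := by
  constructor
  · intro hG x hx
    obtain ⟨n, σ, -, hσ⟩ := hG x 1 hx
    refine ⟨n, (unitaryGroupEquivLinearIsometryEquiv n).toMonoidHom.comp σ, ?_⟩
    simpa using hσ
  · intro hG x y hxy
    obtain ⟨n, ρ, hρ⟩ := hG (x * y⁻¹) (by rwa [Ne, mul_inv_eq_one])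
    obtain ⟨W, hW, ⟨v, hv, hvx⟩, hmin⟩ := exists_minimal_invariant_not_fixed ρ hρ
    let e : W ≃ₗᵢ[ℂ] EuclideanSpace ℂ (Fin (Module.finrank ℂ W)) :=
      (stdOrthonormalBasis ℂ W).repr
    let τ := e.conjMulEquiv.toMonoidHom.comp (restrictIsometricAction ρ W hW)
    let σ := (unitaryGroupEquivLinearIsometryEquiv _).symm.toMonoidHom.comp τ
    have hστ (g : G) : unitaryGroupEquivLinearIsometryEquiv _ (σ g) = τ g := by simp [σ]
    have hτ (g : G) (w : W) : τ g (e w) = e (restrictIsometricAction ρ W hW g w) := by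
      simp [τ, LinearIsometryEquiv.conjMulEquiv]
    let j : W ≃ₗ[ℂ] (Fin (Module.finrank ℂ W) → ℂ) :=
      e.toLinearEquiv.trans (WithLp.linearEquiv 2 ℂ _)
    have hj (g : G) (w : W) :
        unitaryToRepresentation σ g (j w) = j (restrictIsometricAction ρ W hW g w) := by
      change unitaryToRepresentation σ g (e w).ofLp = (e _).ofLp
      rw [unitaryToRepresentation_apply, hστ, hτ]
    refine ⟨_, σ, ?_, ?_⟩
    · have hW₀ : W ≠ ⊥ := by
        rintro rfl
        rw [Submodule.mem_bot] at hv
        simp [hv] at hvx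
      have hsub (U : Subrepresentation (unitaryToRepresentation σ)) :
          U.toSubmodule = ⊥ ∨ U.toSubmodule = ⊤ := by
        have hinv : ∀ g, ∀ v ∈ (U.toSubmodule.comap j.toLinearMap).map W.subtype,
            ρ g v ∈ (U.toSubmodule.comap j.toLinearMap).map W.subtype := by
          rintro g _ ⟨w, hw, rfl⟩
          refine ⟨restrictIsometricAction ρ W hW g w, ?_, rfl⟩
          have := U.apply_mem_toSubmodule g hw
          rw [LinearEquiv.coe_coe, hj] at this
          exact this
        rcases hmin _ (Submodule.map_subtype_le _ _) hinv with h | h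
        · left
          rw [eq_bot_iff]
          intro u hu
          have : (j.symm u : EuclideanSpace ℂ (Fin n)) ∈
              (U.toSubmodule.comap j.toLinearMap).map W.subtype :=
            ⟨j.symm u, by simpa using hu, rfl⟩
          rw [h, Submodule.mem_bot] at this
          simpa using this
        · right
          rw [eq_top_iff]
          intro u _
          have : (j.symm u : EuclideanSpace ℂ (Fin n)) ∈
            (U.toSubmodule.comap j.toLinearMap).map W.subtype := by
            rw [h]
            exact (j.symm u).2
          obtain ⟨w, hw, hwu⟩ := this
          obtain rfl : w = j.symm u := Subtype.ext hwu
          simpa using hw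
      refine { exists_pair_ne := ⟨⊥, ⊤, fun h => hvx ?_⟩, eq_bot_or_eq_top := fun U => ?_ }
      · have hj₀ : j ⟨v, hv⟩ ∈ (⊥ : Submodule ℂ (Fin (Module.finrank ℂ W) → ℂ)) := by
          have : (⊥ : Submodule ℂ (Fin (Module.finrank ℂ W) → ℂ)) = ⊤ :=
            congrArg Subrepresentation.toSubmodule h
          rw [this]
          trivial
        have hv₀ : v = 0 := by simpa using hj₀
        simp [hv₀]
      · rcases hsub U with h | h
        · exact .inl (Subrepresentation.toSubmodule_injective h)
        · exact .inr (Subrepresentation.toSubmodule_injective h)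
    · intro hσ
      have h₁ : σ (x * y⁻¹) = 1 := by rw [map_mul, hσ, ← map_mul, mul_inv_cancel, map_one]
      have h₂ := hτ (x * y⁻¹) ⟨v, hv⟩
      rw [← hστ, h₁, map_one] at h₂
      exact hvx (congrArg Subtype.val (e.injective h₂)).symm

theorem exists_euclidean_action_ne_one {G V : Type*} [Group G] [NormedAddCommGroup V]
    [InnerProductSpace ℂ V] [FiniteDimensional ℂ V] (ρ : G →* (V ≃ₗᵢ[ℂ] V)) {x : G}
    (hx : ρ x ≠ 1) : ∃ (n : ℕ)
      (ρ' : G →* (EuclideanSpace ℂ (Fin n) ≃ₗᵢ[ℂ] EuclideanSpace ℂ (Fin n))), ρ' x ≠ 1 :=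
  ⟨_, (stdOrthonormalBasis ℂ V).repr.conjMulEquiv.toMonoidHom.comp ρ, by simpa using hx⟩

theorem IsMaximallyAlmostPeriodic.of_injective {G K : Type*} [Group G] [Group K]
    (hK : IsMaximallyAlmostPeriodic K) (f : G →* K) (hf : Function.Injective f) :
    IsMaximallyAlmostPeriodic G := by
  rw [isMaximallyAlmostPeriodic_iff] at hK ⊢
  intro x hx
  obtain ⟨n, ρ, hρ⟩ := hK (f x) ((map_ne_one_iff f hf).mpr hx)
  exact ⟨n, ρ.comp f, hρ⟩

/-! ### Residual finiteness -/

theorem Group.residuallyFinite_of_forall_exists_monoidHom.{u} {G : Type*} [Group G]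
    (h : ∀ g : G, g ≠ 1 → ∃ (K : Type u) (_ : Group K) (_ : Group.ResiduallyFinite K)
      (f : G →* K), f g ≠ 1) : Group.ResiduallyFinite G := by
  rw [Group.residuallyFinite_iff_exists_finiteIndex]
  intro g hg
  obtain ⟨K, _, _, f, hf⟩ := h g hg
  obtain ⟨N, hN⟩ := Group.exists_finiteIndexNormalSubgroup_notMem (f g) hf
  exact ⟨(N.comap f).toSubgroup, inferInstance, hN⟩

/-- A residually finite group has a finite index normal subgroup avoiding any given finite set of
nontrivial elements. -/
theorem Group.exists_finiteIndexNormalSubgroup_forall_notMem {G : Type*} [Group G]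
    [Group.ResiduallyFinite G] {S : Set G} (hS : S.Finite) (h1 : 1 ∉ S) :
    ∃ N : Subgroup G, N.Normal ∧ N.FiniteIndex ∧ ∀ s ∈ S, s ∉ N := by
  have : Finite S := hS
  choose N hN using fun s : S => Group.exists_finiteIndexNormalSubgroup_notMem (s : G)
    fun h => h1 (h ▸ s.2)
  refine ⟨⨅ s, (N s).toSubgroup, Subgroup.normal_iInf_normal fun s => inferInstance,
    Subgroup.finiteIndex_iInf fun s => inferInstance, fun s hs hsN => hN ⟨s, hs⟩ ?_⟩
  exact (Subgroup.mem_iInf.mp hsN) ⟨s, hs⟩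

/-! ### Commuting unitaries and commuting pairs -/

theorem LinearIsometryEquiv.isFinitelySemisimple {V : Type*} [NormedAddCommGroup V]
    [InnerProductSpace ℂ V] [FiniteDimensional ℂ V] (u : V ≃ₗᵢ[ℂ] V) :
    Module.End.IsFinitelySemisimple (u.toLinearEquiv : Module.End ℂ V) := by
  rw [Module.End.isFinitelySemisimple_iff_isSemisimple, Module.End.isSemisimple_iff]
  intro p hp
  have hmap : p.map (u.toLinearEquiv : Module.End ℂ V) = p :=
    Submodule.eq_of_le_of_finrank_eq (Submodule.map_le_iff_le_comap.mpr hp)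
      (LinearEquiv.finrank_map_eq u.toLinearEquiv p)
  refine ⟨pᗮ, fun v hv w hw => ?_, Submodule.isCompl_orthogonal p⟩
  rw [← hmap] at hw
  obtain ⟨w, hw, rfl⟩ := hw
  exact (u.inner_map_map w v).trans (hv w hw)

/-- If a group `K` acts by automorphisms on a group `A`, and a finite dimensional unitary
representation `ρ` of `A` with commutative image extends to `K`, then a finite index subgroup of
`K` acts trivially on the image of `ρ`. -/
theorem exists_finiteIndex_forall_map_eq {A K V : Type*} [Group A] [Group K]
    [NormedAddCommGroup V] [InnerProductSpace ℂ V] [FiniteDimensional ℂ V]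
    (φ : K →* MulAut A) (ρ : A →* (V ≃ₗᵢ[ℂ] V)) (τ : K →* (V ≃ₗᵢ[ℂ] V))
    (hφ : ∀ k a, ρ (φ k a) = τ k * ρ a * (τ k)⁻¹) (hcomm : ∀ a b, Commute (ρ a) (ρ b)) :
    ∃ L : Subgroup K, L.FiniteIndex ∧ ∀ k ∈ L, ∀ a, ρ (φ k a) = ρ a := by
  let f : A → Module.End ℂ V := fun a => (ρ a).toLinearEquiv
  have hf : Pairwise fun a b => Commute (f a) (f b) := fun a b _ =>
    LinearMap.ext fun v => congrArg (fun u : V ≃ₗᵢ[ℂ] V => u v) (hcomm a b)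
  have hmaps : ∀ i j φ, Set.MapsTo (f i) ((f j).maxGenEigenspace φ) ((f j).maxGenEigenspace φ) := by
    intro i j φ
    refine Module.End.mapsTo_maxGenEigenspace_of_comm ?_ φ
    rcases eq_or_ne j i with rfl | h
    exacts [Commute.refl _, hf h]
  -- The joint eigenspaces: generalized eigenspaces suit the decomposition theorems, and
  -- semisimplicity of unitaries makes them genuine.
  let E : (A → ℂ) → Submodule ℂ V := fun χ => ⨅ a, (f a).maxGenEigenspace (χ a)
  have hE {χ : A → ℂ} {v : V} : v ∈ E χ ↔ ∀ a, ρ a v = χ a • v := by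
    simp only [E, Submodule.mem_iInf]
    refine forall_congr' fun a => ?_
    rw [(ρ a).isFinitelySemisimple.maxGenEigenspace_eq_eigenspace,
      Module.End.mem_eigenspace_iff]
    rfl
  have htop : ⨆ χ, E χ = ⊤ :=
    Module.End.iSup_iInf_maxGenEigenspace_eq_top_of_forall_mapsTo f hmaps
      fun a => Module.End.iSup_maxGenEigenspace_eq_top (f a)
  have hfin : {χ | E χ ≠ ⊥}.Finite := WellFoundedGT.finite_ne_bot_of_iSupIndep
    (Module.End.independent_iInf_maxGenEigenspace_of_forall_mapsTo f hmaps)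
  let _ : MulAction K A := MulAction.compHom A φ
  let _ : MulAction K (A → ℂ) := arrowAction
  have hsmul (k : K) (χ : A → ℂ) (a : A) : (k • χ) a = χ (φ k⁻¹ a) := rfl
  -- `τ k` carries `E χ` into `E (k • χ)`, so `K` permutes the finite set of occurring weights.
  have hinv (k : K) {χ : A → ℂ} (hχ : E χ ≠ ⊥) : E (k • χ) ≠ ⊥ := by
    obtain ⟨v, hv, hv0⟩ := Submodule.exists_mem_ne_zero_of_ne_bot hχ
    refine Submodule.ne_bot_iff _ |>.mpr ⟨τ k v, hE.mpr fun a => ?_, by simpa using hv0⟩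
    have h := hE.mp hv (φ k⁻¹ a)
    rw [hφ, map_inv, inv_inv] at h
    have h' := congrArg (τ k) h
    rw [map_smul] at h'
    rw [hsmul, ← h']
    change ρ a (τ k v) = (τ k * ((τ k)⁻¹ * ρ a * τ k)) v
    rw [mul_assoc, mul_inv_cancel_left]
    rfl
  have hstab (χ : A → ℂ) (hχ : E χ ≠ ⊥) : (MulAction.stabilizer K χ).FiniteIndex := by
    have : Finite (MulAction.orbit K χ) := hfin.subset (by
      rintro _ ⟨k, rfl⟩
      exact hinv k hχ)
    have := (MulAction.orbitEquivQuotientStabilizer K χ).finite_iff.mp this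
    exact Subgroup.finiteIndex_of_finite_quotient
  have : Finite {χ // E χ ≠ ⊥} := hfin
  refine ⟨⨅ χ : {χ // E χ ≠ ⊥}, MulAction.stabilizer K χ.1,
    Subgroup.finiteIndex_iInf fun χ => hstab χ χ.2, fun k hk a => ?_⟩
  ext v
  have hv : v ∈ ⨆ χ, E χ := htop ▸ Submodule.mem_top
  induction hv using Submodule.iSup_induction' with
  | mem χ v hv =>
    rcases eq_or_ne (E χ) ⊥ with h | h
    · rw [h, Submodule.mem_bot] at hv
      simp [hv]
    · have hkχ : k⁻¹ • χ = χ := by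
        have : k⁻¹ ∈ MulAction.stabilizer K χ :=
          inv_mem (Subgroup.mem_iInf.mp hk ⟨χ, h⟩)
        exact this
      rw [hE.mp hv, hE.mp hv, ← congrFun hkχ a, hsmul, inv_inv]
  | zero => simp
  | add v w _ _ hv hw => rw [map_add, map_add, hv, hw]

/-- A finite dimensional algebra has no infinite sequence of mutually commuting noncommuting
pairs. -/
theorem exists_commute_of_pairwise_commute {R : Type*} [Ring R] [Algebra ℂ R]
    [FiniteDimensional ℂ R] (x y : ℕ → R) (h : ∀ i j, i ≠ j → Commute (x i) (y j)) :
    ∃ i, Commute (x i) (y i) := by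
  -- These centralizers decrease with `k`, so they stabilize at some `n`; then `x n`, which lies in
  -- `C n`, also commutes with `y n`.
  let C : ℕ → Submodule ℂ R := fun k =>
    (Subalgebra.centralizer ℂ (y '' Set.Iio k)).toSubmodule
  have hC {k : ℕ} {m : R} : m ∈ C k ↔ ∀ i < k, y i * m = m * y i := by
    simp [C, Subalgebra.mem_centralizer_iff]
  have hanti : Antitone C := fun k l hkl m hm => hC.mpr fun i hi => hC.mp hm i (hi.trans_le hkl)
  obtain ⟨n, hn⟩ := WellFoundedGT.monotone_chain_condition
    (⟨fun k => OrderDual.toDual (C k), hanti⟩ : ℕ →o (Submodule ℂ R)ᵒᵈ)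
  have hx : x n ∈ C n := hC.mpr fun i hi => ((h n i hi.ne').eq).symm
  have hCn : C n = C (n + 1) := hn (n + 1) n.le_succ
  rw [hCn] at hx
  exact ⟨n, (hC.mp hx n n.lt_succ_self).symm⟩

/-! ### Restricted direct powers -/

namespace finSuppPower

variable {Λ H : Type*} [Group Λ]

open Classical in
/-- The copy of `Λ` with a given index in `⨁_{h ∈ H} Λ`. -/
noncomputable def single (h : H) : Λ →* finSuppPower Λ H where
  toFun a := ⟨Pi.mulSingle h a, (Set.finite_singleton h).subset Pi.mulSupport_mulSingle_subset⟩
  map_one' := Subtype.ext (Pi.mulSingle_one h)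
  map_mul' a b := Subtype.ext (Pi.mulSingle_mul (f := fun _ : H => Λ) h a b)

@[simp]
theorem single_apply_self (h : H) (a : Λ) : (single h a).1 h = a := by
  simp [single]

theorem single_apply_of_ne {h k : H} (hk : k ≠ h) (a : Λ) : (single h a).1 k = 1 := by
  simp [single, hk]

theorem single_injective (h : H) : Function.Injective (single h : Λ →* finSuppPower Λ H) :=
  fun a b hab => by simpa using congrArg (fun f => f.1 h) hab

theorem commute_single {h k : H} (hk : h ≠ k) (a b : Λ) :
    Commute (single h a : finSuppPower Λ H) (single k b) := by
  ext l
  rcases eq_or_ne l h with rfl | hl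
  · simp [single_apply_of_ne hk]
  · simp [single_apply_of_ne hl]

theorem shiftAction_single [Group H] (h k : H) (a : Λ) :
    shiftAction Λ H h (single k a) = single (h * k) a := by
  ext l
  change (single k a).1 (h⁻¹ * l) = _
  rcases eq_or_ne l (h * k) with rfl | hl
  · simp
  · rw [single_apply_of_ne hl, single_apply_of_ne]
    rintro rfl
    simp at hl

/-- The map of direct powers induced by a homomorphism of the base groups. -/
def mapBase {Λ' : Type*} [Group Λ'] (f : Λ →* Λ') : finSuppPower Λ H →* finSuppPower Λ' H where
  toFun x := ⟨fun h => f (x.1 h), x.2.subset (Function.mulSupport_comp_subset f.map_one x.1)⟩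
  map_one' := by ext; simp
  map_mul' x y := by ext; simp

/-- Multiplication over the fibers of a map of index sets, for a commutative base group. -/
noncomputable def fiberProd {M Q : Type*} [CommGroup M] [Finite Q] (q : H → Q) :
    finSuppPower M H →* finSuppPower M Q where
  toFun x := ⟨fun k => ∏ᶠ h : q ⁻¹' {k}, x.1 h, Set.toFinite _⟩
  map_one' := by ext; simp
  map_mul' x y := by
    ext k
    exact finprod_mul_distrib (x.2.preimage Subtype.val_injective.injOn)
      (y.2.preimage Subtype.val_injective.injOn)

theorem fiberProd_apply {M Q : Type*} [CommGroup M] [Finite Q] (q : H → Q)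
    (x : finSuppPower M H) (k : Q) : (fiberProd q x).1 k = ∏ᶠ h : q ⁻¹' {k}, x.1 h :=
  rfl

end finSuppPower

/-! ### Wreath products: functoriality and finite acting groups -/

namespace RestrictedWreathProduct

/-- Functoriality of the wreath product in the base group. -/
def mapBase {Λ Λ' : Type*} (H : Type*) [Group Λ] [Group Λ'] [Group H] (f : Λ →* Λ') :
    RestrictedWreathProduct Λ H →* RestrictedWreathProduct Λ' H :=
  SemidirectProduct.map (finSuppPower.mapBase f) (MonoidHom.id H) fun _ => rfl

/-- Functoriality of the wreath product in the acting group, for a commutative base group. -/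
noncomputable def mapActing (M : Type*) {H Q : Type*} [CommGroup M] [Group H] [Group Q] [Finite Q]
    (q : H →* Q) : RestrictedWreathProduct M H →* RestrictedWreathProduct M Q :=
  SemidirectProduct.map (finSuppPower.fiberProd q) q fun a => by
    ext x k
    change ∏ᶠ h : q ⁻¹' {k}, x.1 (a⁻¹ * h) = ∏ᶠ h : q ⁻¹' {(q a)⁻¹ * k}, x.1 h
    let e : q ⁻¹' {k} ≃ q ⁻¹' {(q a)⁻¹ * k} :=
      (Equiv.mulLeft a⁻¹).subtypeEquiv fun h => by simp
    exact finprod_comp_equiv e (f := fun h : q ⁻¹' {(q a)⁻¹ * k} => x.1 h)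

theorem inl_single_injective {Λ H : Type*} [Group Λ] [Group H] (h : H) :
    Function.Injective ((SemidirectProduct.inl : _ →* RestrictedWreathProduct Λ H).comp
      (finSuppPower.single h)) :=
  SemidirectProduct.inl_injective.comp (finSuppPower.single_injective h)

/-- If `M` is commutative and `H` is residually finite then every nontrivial element of `M ≀ H`
survives in `M ≀ Q` for some finite quotient `Q` of `H`. -/
theorem exists_mapActing_ne_one {M H : Type*} [CommGroup M] [Group H] [Group.ResiduallyFinite H]
    {g : RestrictedWreathProduct M H} (hg : g ≠ 1) :
    ∃ (N : Subgroup H) (_ : N.Normal) (_ : Finite (H ⧸ N)),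
      mapActing M (QuotientGroup.mk' N) g ≠ 1 := by
  rcases ne_or_eq g.right 1 with hr | hr
  · obtain ⟨N, hN⟩ := Group.exists_finiteIndexNormalSubgroup_notMem g.right hr
    refine ⟨N.toSubgroup, inferInstance, inferInstance, fun h => hN ?_⟩
    have := congrArg SemidirectProduct.right h
    exact (QuotientGroup.eq_one_iff _).mp this
  · obtain ⟨h₀, hh₀⟩ : ∃ h, g.left.1 h ≠ 1 := by
      contrapose! hg
      exact SemidirectProduct.ext (Subtype.ext (funext hg)) hr
    -- `N` isolates `h₀` from the rest of the support modulo `N`, so the product over its fiber is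
    -- the single factor at `h₀`.
    obtain ⟨N, _, _, hN⟩ := Group.exists_finiteIndexNormalSubgroup_forall_notMem
      (S := (fun h => h₀⁻¹ * h) '' (Function.mulSupport g.left.1 \ {h₀}))
      ((g.left.2.sdiff).image _) (by
        rintro ⟨h, ⟨-, hh⟩, hh'⟩
        exact hh (inv_mul_eq_one.mp hh').symm)
    refine ⟨N, inferInstance, inferInstance, fun h => hh₀ ?_⟩
    have hk : (finSuppPower.fiberProd (QuotientGroup.mk' N) g.left).1 h₀ = 1 :=
      congrFun (congrArg (fun x => x.left.1) h) (h₀ : H ⧸ N)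
    rw [finSuppPower.fiberProd_apply, finprod_eq_single _ ⟨h₀, rfl⟩] at hk
    · exact hk
    · rintro ⟨h, hh⟩ hne
      by_contra hsupp
      refine hN _ ⟨h, ⟨hsupp, fun h' => hne (Subtype.ext h')⟩, rfl⟩ ?_
      exact QuotientGroup.eq.mp (Eq.symm hh)

/-- The monomial action of `Λ ≀ H` on `V^H` induced by an isometric action of `Λ` on `V`. -/
noncomputable def monomialAction {Λ V : Type*} (H : Type*) [Group Λ] [Group H] [Fintype H]
    [NormedAddCommGroup V] [InnerProductSpace ℂ V] (σ : Λ →* (V ≃ₗᵢ[ℂ] V)) :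
    RestrictedWreathProduct Λ H →*
      (PiLp 2 (fun _ : H => V) ≃ₗᵢ[ℂ] PiLp 2 (fun _ : H => V)) where
  toFun g := (LinearIsometryEquiv.piLpCongrLeft 2 ℂ V (Equiv.mulLeft g.right)).trans
    (LinearIsometryEquiv.piLpCongrRight 2 fun k => σ (g.left.1 k))
  map_one' := by
    ext v k
    change σ 1 (v (1⁻¹ * k)) = v k
    simp
  map_mul' g g' := by
    ext v k
    change σ (g.left.1 k * g'.left.1 (g.right⁻¹ * k)) (v ((g.right * g'.right)⁻¹ * k)) =
      σ (g.left.1 k) (σ (g'.left.1 (g.right⁻¹ * k)) (v (g'.right⁻¹ * (g.right⁻¹ * k))))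
    rw [map_mul, mul_inv_rev, mul_assoc]
    rfl

theorem monomialAction_apply {Λ V : Type*} (H : Type*) [Group Λ] [Group H] [Fintype H]
    [NormedAddCommGroup V] [InnerProductSpace ℂ V] (σ : Λ →* (V ≃ₗᵢ[ℂ] V))
    (g : RestrictedWreathProduct Λ H) (v : PiLp 2 (fun _ : H => V)) (k : H) :
    monomialAction H σ g v k = σ (g.left.1 k) (v (g.right⁻¹ * k)) :=
  rfl

theorem isMaximallyAlmostPeriodic_of_finite {Λ H : Type*} [Group Λ] [Group H] [Finite H]
    (hΛ : IsMaximallyAlmostPeriodic Λ) :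
    IsMaximallyAlmostPeriodic (RestrictedWreathProduct Λ H) := by
  classical
  have := Fintype.ofFinite H
  rw [isMaximallyAlmostPeriodic_iff] at hΛ ⊢
  intro g hg
  rcases ne_or_eq g.right 1 with hr | hr
  -- With the trivial action on `ℂ` this is the left regular representation, which detects the
  -- `H`-component.
  · refine exists_euclidean_action_ne_one
      (monomialAction H (1 : Λ →* (ℂ ≃ₗᵢ[ℂ] ℂ))) (x := g) fun h => ?_
    have := congrArg (fun u => u (PiLp.single 2 (1 : H) (1 : ℂ)) g.right) h
    simp [monomialAction_apply, hr] at this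
  · obtain ⟨k, hk⟩ : ∃ h, g.left.1 h ≠ 1 := by
      contrapose! hg
      exact SemidirectProduct.ext (Subtype.ext (funext hg)) hr
    obtain ⟨n, σ, hσ⟩ := hΛ _ hk
    refine exists_euclidean_action_ne_one (monomialAction H σ) (x := g) fun h => hσ ?_
    ext1 v
    have := congrArg (fun u => u (PiLp.single 2 k v) k) h
    simpa [monomialAction_apply, hr] using this

theorem residuallyFinite_of_finite {Λ H : Type*} [Group Λ] [Group H] [Finite H]
    [Group.ResiduallyFinite Λ] : Group.ResiduallyFinite (RestrictedWreathProduct Λ H) := by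
  refine Group.residuallyFinite_of_forall_exists_monoidHom fun g hg => ?_
  have hfin (Λ' : Type _) [Group Λ'] [Finite Λ'] :
      Group.ResiduallyFinite (RestrictedWreathProduct Λ' H) := by
    have : Finite (RestrictedWreathProduct Λ' H) :=
      Finite.of_equiv _ SemidirectProduct.equivProd.symm
    infer_instance
  rcases ne_or_eq g.right 1 with hr | hr
  -- The quotient by `⊤` is a trivial base group living in the universe of `Λ`.
  · refine ⟨RestrictedWreathProduct (Λ ⧸ (⊤ : Subgroup Λ)) H, inferInstance, hfin _,
      mapBase H (QuotientGroup.mk' ⊤), fun h => hr ?_⟩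
    exact congrArg SemidirectProduct.right h
  · obtain ⟨k, hk⟩ : ∃ h, g.left.1 h ≠ 1 := by
      contrapose! hg
      exact SemidirectProduct.ext (Subtype.ext (funext hg)) hr
    obtain ⟨N, hN⟩ := Group.exists_finiteIndexNormalSubgroup_notMem _ hk
    refine ⟨RestrictedWreathProduct (Λ ⧸ N.toSubgroup) H, inferInstance, hfin _,
      mapBase H (QuotientGroup.mk' N.toSubgroup), fun h => hN ?_⟩
    have := congrFun (congrArg (fun x => x.left.1) h) k
    exact (QuotientGroup.eq_one_iff _).mp this

end RestrictedWreathProduct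

theorem Group.ResiduallyFinite.isMaximallyAlmostPeriodic {G : Type*} [Group G]
    (hG : Group.ResiduallyFinite G) : IsMaximallyAlmostPeriodic G := by
  rw [isMaximallyAlmostPeriodic_iff]
  intro g hg
  obtain ⟨N, hN⟩ := Group.exists_finiteIndexNormalSubgroup_notMem g hg
  -- The finite quotient embeds in its wreath product with trivial base.
  have hQ : IsMaximallyAlmostPeriodic (G ⧸ N.toSubgroup) :=
    (RestrictedWreathProduct.isMaximallyAlmostPeriodic_of_finite (Λ := Unit)
      fun x y h => (h rfl).elim).of_injective SemidirectProduct.inr SemidirectProduct.inr_injective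
  obtain ⟨n, ρ, hρ⟩ := isMaximallyAlmostPeriodic_iff.mp hQ (g : G ⧸ N.toSubgroup)
    fun h => hN ((QuotientGroup.eq_one_iff g).mp h)
  exact ⟨n, ρ.comp (QuotientGroup.mk' N.toSubgroup), hρ⟩

theorem Group.ResiduallyFinite.of_injective {G K : Type*} [Group G] [Group K]
    (hK : Group.ResiduallyFinite K) (f : G →* K) (hf : Function.Injective f) :
    Group.ResiduallyFinite G :=
  Group.residuallyFinite_of_forall_exists_monoidHom fun _ hg =>
    ⟨K, inferInstance, hK, f, (map_ne_one_iff f hf).mpr hg⟩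

/-! ### Necessity of the conditions -/

namespace IsMaximallyAlmostPeriodic

open scoped commutatorElement

variable {Λ H : Type*} [Group Λ] [Group H]

theorem commute_of_wreathProduct (h : IsMaximallyAlmostPeriodic (RestrictedWreathProduct Λ H))
    [Infinite H] (a b : Λ) : Commute a b := by
  by_contra hab
  have hne : (SemidirectProduct.inl (finSuppPower.single (1 : H) ⁅a, b⁆) :
      RestrictedWreathProduct Λ H) ≠ 1 :=
    (map_ne_one_iff _ (RestrictedWreathProduct.inl_single_injective 1)).mpr
      fun h => hab (commutatorElement_eq_one_iff_commute.mp h)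
  obtain ⟨n, ρ, hρ⟩ := isMaximallyAlmostPeriodic_iff.mp h _ hne
  let j (k : H) : Λ →* RestrictedWreathProduct Λ H :=
    SemidirectProduct.inl.comp (finSuppPower.single k)
  have hconj (k : H) (c : Λ) : j k c = SemidirectProduct.inr k * j 1 c *
      (SemidirectProduct.inr k)⁻¹ := by
    simp only [j, MonoidHom.comp_apply]
    rw [← map_inv, ← SemidirectProduct.inl_aut, finSuppPower.shiftAction_single, mul_one]
  let s := Infinite.natEmbedding H
  let T (g : RestrictedWreathProduct Λ H) : Module.End ℂ (EuclideanSpace ℂ (Fin n)) :=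
    (ρ g).toLinearEquiv
  have hT (g g' : RestrictedWreathProduct Λ H) : Commute (T g) (T g') ↔ Commute (ρ g) (ρ g') :=
    ⟨fun h => LinearIsometryEquiv.ext fun v => LinearMap.congr_fun h v,
      fun h => LinearMap.ext fun v => congrArg (fun u => u v) h⟩
  obtain ⟨i, hi⟩ := exists_commute_of_pairwise_commute (fun i => T (j (s i) a))
    (fun i => T (j (s i) b)) fun i k hik => (hT _ _).mpr
      (((finSuppPower.commute_single (s.injective.ne hik) a b).map SemidirectProduct.inl).map ρ)
  rw [hT, ← commutatorElement_eq_one_iff_commute, ← map_commutatorElement,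
    ← map_commutatorElement, hconj, map_mul, map_mul, map_inv, conj_eq_one_iff] at hi
  exact hρ hi

theorem residuallyFinite_of_wreathProduct [Nontrivial Λ]
    (h : IsMaximallyAlmostPeriodic (RestrictedWreathProduct Λ H)) :
    Group.ResiduallyFinite H := by
  rcases finite_or_infinite H with _ | _
  · infer_instance
  rw [Group.residuallyFinite_iff_exists_finiteIndex]
  intro k hk
  obtain ⟨a, ha⟩ := exists_ne (1 : Λ)
  -- Shifting by `k` takes the second factor to the first, so a representation whose restriction to
  -- the base is invariant under `k` kills `x`.
  let x : finSuppPower Λ H := finSuppPower.single k a / finSuppPower.single 1 a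
  have hx : x ≠ 1 := fun hx => ha (by
    simpa [finSuppPower.single_apply_of_ne hk.symm] using
      congrFun (congrArg Subtype.val (div_eq_one.mp hx)).symm 1)
  obtain ⟨n, ρ, hρ⟩ := isMaximallyAlmostPeriodic_iff.mp h (SemidirectProduct.inl x)
    ((map_ne_one_iff _ SemidirectProduct.inl_injective).mpr hx)
  obtain ⟨L, hL, hLρ⟩ := exists_finiteIndex_forall_map_eq (shiftAction Λ H)
    (ρ.comp SemidirectProduct.inl) (ρ.comp SemidirectProduct.inr)
    (fun k f => by
      simp only [MonoidHom.comp_apply]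
      rw [SemidirectProduct.inl_aut, map_mul, map_mul, map_inv, map_inv])
    (fun f g => by
      refine Commute.map (?_ : Commute f g) _
      ext l
      exact h.commute_of_wreathProduct (f.1 l) (g.1 l))
  refine ⟨L, hL, fun hkL => hρ ?_⟩
  have := hLρ k hkL (finSuppPower.single 1 a)
  rw [finSuppPower.shiftAction_single, mul_one] at this
  simp only [MonoidHom.comp_apply] at this
  rw [map_div, map_div, this, div_self']

end IsMaximallyAlmostPeriodic

theorem mainTheorem6 (Λ H : Type*) [Group Λ] [Group H] [Countable Λ] [Countable H]
    [Nontrivial Λ] :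
    (IsMaximallyAlmostPeriodic (RestrictedWreathProduct Λ H) ↔
      IsMaximallyAlmostPeriodic Λ ∧ Group.ResiduallyFinite H ∧
        (Finite H ∨ ∀ a b : Λ, a * b = b * a)) ∧
    (Group.ResiduallyFinite (RestrictedWreathProduct Λ H) ↔
      Group.ResiduallyFinite Λ ∧ Group.ResiduallyFinite H ∧
        (Finite H ∨ ∀ a b : Λ, a * b = b * a)) := by
  have hcomm (h : IsMaximallyAlmostPeriodic (RestrictedWreathProduct Λ H)) :
      Finite H ∨ ∀ a b : Λ, a * b = b * a :=
    (finite_or_infinite H).imp_right fun (_ : Infinite H) => h.commute_of_wreathProduct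
  have hinj := RestrictedWreathProduct.inl_single_injective (Λ := Λ) (1 : H)
  constructor
  · refine ⟨fun h => ⟨h.of_injective _ hinj, h.residuallyFinite_of_wreathProduct, hcomm h⟩, ?_⟩
    rintro ⟨hΛ, hH, hfin | hab⟩
    · exact RestrictedWreathProduct.isMaximallyAlmostPeriodic_of_finite hΛ
    · let _ : CommGroup Λ := { ‹Group Λ› with mul_comm := hab }
      rw [isMaximallyAlmostPeriodic_iff]
      intro g hg
      obtain ⟨N, _, _, hN⟩ := RestrictedWreathProduct.exists_mapActing_ne_one hg
      obtain ⟨n, ρ, hρ⟩ := isMaximallyAlmostPeriodic_iff.mp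
        (RestrictedWreathProduct.isMaximallyAlmostPeriodic_of_finite hΛ) _ hN
      exact ⟨n, ρ.comp (RestrictedWreathProduct.mapActing Λ (QuotientGroup.mk' N)), hρ⟩
  · refine ⟨fun h => ⟨h.of_injective _ hinj,
      h.isMaximallyAlmostPeriodic.residuallyFinite_of_wreathProduct,
      hcomm h.isMaximallyAlmostPeriodic⟩, ?_⟩
    rintro ⟨hΛ, hH, hfin | hab⟩
    · exact RestrictedWreathProduct.residuallyFinite_of_finite
    · let _ : CommGroup Λ := { ‹Group Λ› with mul_comm := hab }
      refine Group.residuallyFinite_of_forall_exists_monoidHom fun g hg => ?_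
      obtain ⟨N, _, _, hN⟩ := RestrictedWreathProduct.exists_mapActing_ne_one hg
      exact ⟨_, _, RestrictedWreathProduct.residuallyFinite_of_finite, _, hN⟩
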